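/- Let $d\ge 1$. Write $\widehat f$ for the Fourier transform on $L_2(\mathbb R^d)$ extending $\int_{\mathbb R^d} f(x)e^{-2\pi i\langle x,\xi\rangle}\,dx$, and $H^1(\mathbb R^d)$ for the space of $f\in L_2(\mathbb R^d)$ all of whose first-order (weak) partial derivatives are in $L_2(\mathbb R^d)$. A non-zero continuously differentiable function $f:\mathbb R^d\to\mathbb C$ in $L_2(\mathbb R^d)$ is called admissible if $f\in H^1(\mathbb R^d)$, $\widehat f\in H^1(\mathbb R^d)$, and there are constants $C_1,C_2>0$, $\beta>d$ and $\gamma>\max\{\frac d2+1,d\}$ such that $$|f(x)|\le \frac{C_1}{\|x\|^{\gamma}},\qquad \Big|\frac{\partial f}{\partial x_j}(x)\Big|\le\frac{C_2}{\|x\|^{\beta}}\qquad\text{for all } x\in\mathbb R^d\setminus\{0\},\ j=1,\dots,d.$$ For $L\in\mathbb R^d\setminus\{0\}$ let $\frac{\partial f}{\partial L}=\sum_{j} L_j\frac{\partial f}{\partial x_j}$, $\mathcal A_Lf(x)=2\pi\langle L,x\rangle f(x)$, $\mathcal B_Lf(x)=\frac{i}{2\pi}\frac{\partial f}{\partial L}(x)$.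 With the norm and inner product of $L_2(\mathbb R^d)$, let $\Delta(\mathcal A,f)=\|\mathcal A f\|_2^2-|\langle\mathcal A f,f\rangle|^2/\|f\|_2^2$ and $$\mathrm{UP}_L(f)=\frac{\Delta(\mathcal A_L,f)\,\Delta(\mathcal B_L,f)}{\|L\|^4\,\|f\|_2^4}.$$ Let $\mathbb T^d=\mathbb R^d/\mathbb Z^d$, represented by $[-\frac12,\frac12)^d$, and let $\|\cdot\|_{\mathbb T^d}$, $\langle\cdot,\cdot\rangle_{\mathbb T^d}$ be the norm and inner product of $L_2(\mathbb T^d)$. For $L\in\mathbb Z^d\setminus\{0\}$ let $\mathcal A_L^{\mathbb T^d}g(x)=e^{2\pi i\langle L,x\rangle}g(x)$, $\mathcal B_L^{\mathbb T^d}g=\frac{i}{2\pi}\frac{\partial g}{\partial L}$, and $$\mathrm{UP}_L^{\mathbb T^d}(g)=\frac1{\|L\|^4}\left(\frac{\|g\|_{\mathbb T^d}^4}{|\langle\mathcal A_L^{\mathbb T^d}g,g\rangle_{\mathbb T^d}|^2}-1\right)\left(\frac{\|\mathcal B_L^{\mathbb T^d}g\|_{\mathbb T^d}^2}{\|g\|_{\mathbb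 T^d}^2}-\frac{|\langle\mathcal B_L^{\mathbb T^d}g,g\rangle_{\mathbb T^d}|^2}{\|g\|_{\mathbb T^d}^4}\right).$$ **Theorem.** Let $f$ be admissible and $L\in\mathbb Z^d\setminus\{0\}$. For $\lambda>0$ put $f_\lambda(x)=\sqrt{\lambda^d}\,f(\lambda x)$ and $f_\lambda^{\mathrm{per}}(x)=\sum_{k\in\mathbb Z^d}f_\lambda(x+k)$. Then $\mathcal A_Lf,\mathcal B_Lf\in L_2(\mathbb R^d)$; for every $\lambda>0$ the series converges absolutely at every $x\in\mathbb R^d$ and its sum $f_\lambda^{\mathrm{per}}$ is $\mathbb Z^d$-periodic and continuously differentiable; for all sufficiently large $\lambda$ one has $\|f_\lambda^{\mathrm{per}}\|_{\mathbb T^d}\ne0$ and $\langle\mathcal A_L^{\mathbb T^d}f_\lambda^{\mathrm{per}},f_\lambda^{\mathrm{per}}\rangle_{\mathbb T^d}\neq0$ (so that $\mathrm{UP}_L(f)$ and $\mathrm{UP}_L^{\mathbb T^d}(f_\lambda^{\mathrm{per}})$ are well defined); and $$\lim_{\lambda\to\infty}\mathrm{UP}_L^{\mathbb T^d}(f_\lambda^{\mathrm{per}})=\mathrm{UP}_L(f).$$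 -/

import Mathlib

open MeasureTheory Filter Topology
open scoped FourierTransform SchwartzMap LineDeriv ENNReal

noncomputable section

namespace DirUP

/-- The Euclidean space `ℝ^d`. -/
abbrev Rd (d : ℕ) := EuclideanSpace ℝ (Fin d)

/-- A lattice point `k ∈ ℤ^d` as a vector of `ℝ^d`. -/
def lat {d : ℕ} (k : Fin d → ℤ) : Rd d := WithLp.toLp 2 fun j => (k j : ℝ)

/-- The fundamental cube `[-1/2, 1/2)^d` that represents the torus `𝕋^d = ℝ^d / ℤ^d`.
Functions on `𝕋^d` are `ℤ^d`-periodic functions on `ℝ^d`, integrated over this cube. -/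
def cube (d : ℕ) : Set (Rd d) := {x | ∀ j, x j ∈ Set.Ico (-(1 / 2) : ℝ) (1 / 2)}

/-- Integration over `𝕋^d`. -/
def torusMeasure (d : ℕ) : Measure (Rd d) := (volume : Measure (Rd d)).restrict (cube d)

/-- The `L₂(μ)` inner product `∫ f(x) conj(g(x)) dμ(x)`, linear in the first argument. -/
def ip {d : ℕ} (μ : Measure (Rd d)) (f g : Rd d → ℂ) : ℂ :=
  ∫ x, f x * (starRingEnd ℂ) (g x) ∂μ

/-- The squared `L₂(μ)` norm `∫ |f(x)|² dμ(x)`. -/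
def normSq {d : ℕ} (μ : Measure (Rd d)) (f : Rd d → ℂ) : ℝ := ∫ x, ‖f x‖ ^ 2 ∂μ

/-- The partial derivative `∂f/∂x_j`. -/
def partialD {d : ℕ} (j : Fin d) (f : Rd d → ℂ) (x : Rd d) : ℂ :=
  fderiv ℝ f x (EuclideanSpace.single j 1)

/-- The directional derivative `∂f/∂L = ∑_j L_j ∂f/∂x_j` of a continuously differentiable `f`. -/
def dirD {d : ℕ} (L : Rd d) (f : Rd d → ℂ) (x : Rd d) : ℂ :=
  ∑ j, (L j : ℂ) * partialD j f x

/-- `A_L f(x) = 2π⟨L, x⟩ f(x)`. -/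
def opA {d : ℕ} (L : Rd d) (f : Rd d → ℂ) (x : Rd d) : ℂ :=
  ((2 * Real.pi * inner ℝ L x : ℝ) : ℂ) * f x

/-- `B_L f(x) = (i / 2π) ∂f/∂L(x)`; the same formula defines the periodic operator. -/
def opB {d : ℕ} (L : Rd d) (f : Rd d → ℂ) (x : Rd d) : ℂ :=
  (Complex.I / (2 * Real.pi)) * dirD L f x

/-- The periodic operator `A_L^{𝕋^d} f(x) = exp(2πi⟨L, x⟩) f(x)`. -/
def opAT {d : ℕ} (L : Rd d) (f : Rd d → ℂ) (x : Rd d) : ℂ :=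
  Complex.exp (2 * Real.pi * Complex.I * (inner ℝ L x : ℝ)) * f x

/-- The variance `Δ(A, f) = ‖A f‖² - |⟨A f, f⟩|² / ‖f‖²` in `L₂(ℝ^d)`. -/
def variance {d : ℕ} (A : (Rd d → ℂ) → Rd d → ℂ) (f : Rd d → ℂ) : ℝ :=
  normSq volume (A f) - ‖ip volume (A f) f‖ ^ 2 / normSq volume f

/-- The directional uncertainty product `UP_L(f)` on `ℝ^d`. -/
def UP {d : ℕ} (L : Rd d) (f : Rd d → ℂ) : ℝ :=
  variance (opA L) f * variance (opB L) f / (‖L‖ ^ 4 * normSq volume f ^ 2)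

/-- The angular directional variance on `𝕋^d`. -/
def varAng {d : ℕ} (L : Rd d) (f : Rd d → ℂ) : ℝ :=
  normSq (torusMeasure d) f ^ 2 / ‖ip (torusMeasure d) (opAT L f) f‖ ^ 2 - 1

/-- The frequency directional variance on `𝕋^d`. -/
def varFreq {d : ℕ} (L : Rd d) (f : Rd d → ℂ) : ℝ :=
  normSq (torusMeasure d) (opB L f) / normSq (torusMeasure d) f
    - ‖ip (torusMeasure d) (opB L f) f‖ ^ 2 / normSq (torusMeasure d) f ^ 2

/-- The periodic directional uncertainty product `UP_L^{𝕋^d}(f)`. -/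
def UPT {d : ℕ} (L : Rd d) (f : Rd d → ℂ) : ℝ :=
  1 / ‖L‖ ^ 4 * (varAng L f * varFreq L f)

/-- `u ∈ L₂(ℝ^d)` lies in `H¹(ℝ^d)`: all its first-order partial derivatives, in the sense of
tempered distributions, are in `L₂(ℝ^d)`. -/
def MemH1 {d : ℕ} (u : Lp ℂ 2 (volume : Measure (Rd d))) : Prop :=
  ∀ j : Fin d, ∃ g : Lp ℂ 2 (volume : Measure (Rd d)),
    ∂_{(EuclideanSpace.single j 1 : Rd d)} (u : 𝓢'(Rd d, ℂ)) = (g : 𝓢'(Rd d, ℂ))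

/-- Admissible functions. The Fourier transform is the unitary one on `L₂(ℝ^d)`, extending
`∫ f(x) exp(-2πi⟨x, ξ⟩) dx`. The decay bounds hold trivially at `x = 0` (infinite right-hand
side), so they are stated for `x ≠ 0`. -/
structure Admissible {d : ℕ} (f : Rd d → ℂ) : Prop where
  ne_zero : f ≠ 0
  contDiff : ContDiff ℝ 1 f
  memLp : MemLp f 2 (volume : Measure (Rd d))
  memH1 : MemH1 (memLp.toLp f)
  fourier_memH1 : MemH1 (𝓕 (memLp.toLp f))
  decay : ∃ C₁ C₂ γ β : ℝ, 0 < C₁ ∧ 0 < C₂ ∧ (d : ℝ) < β ∧ max ((d : ℝ) / 2 + 1) d < γ ∧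
    (∀ x : Rd d, x ≠ 0 → ‖f x‖ ≤ C₁ / ‖x‖ ^ γ) ∧
    ∀ x : Rd d, x ≠ 0 → ∀ j : Fin d, ‖partialD j f x‖ ≤ C₂ / ‖x‖ ^ β

/-- The scaled function `f_lam(x) = √(lam^d) f(lam x)`. -/
def scaled {d : ℕ} (lam : ℝ) (f : Rd d → ℂ) (x : Rd d) : ℂ :=
  (Real.sqrt (lam ^ d) : ℂ) * f (lam • x)

/-- The periodization `f_lam^per(x) = ∑_{k ∈ ℤ^d} f_lam(x + k)`. -/
def periodized {d : ℕ} (lam : ℝ) (f : Rd d → ℂ) (x : Rd d) : ℂ :=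
  ∑' k : Fin d → ℤ, scaled lam f (x + lat k)

end DirUP

end

/-! Put S(y) = ∑ₖ f(y + λk). The substitution y = λx turns every torus integral of the periodization
into an integral over the cube λ[-1/2, 1/2)^d of a weight times a product of lattice sums, and each
derivative contributes one factor λ. As λ → ∞ the cubes exhaust ℝ^d and S(y) → f(y), since only the
term k = 0 survives. On the cube S is bounded by C(1 + ‖y‖)^(-s) with C independent of λ ≥ 1
(`HasDecay.latticeSum_le`), so dominated convergence applies (`tendsto_pairing`). The frequency
variance, divided by λ², therefore converges to Δ(B_L, f)/‖f‖². For the angular variance let N be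
the squared norm of the periodization and P = ⟨A g, g⟩ its pairing with the character. The identity
N² - |P|² = N(2N - P - conj P) - |P - N|² brings in the difference quotient q = λ(χ - 1), where χ(y)
= exp(2πi⟨L, y⟩/λ): λ²(N² - |P|²) = N ∫|q|²|S|² - |∫ q|S|²|². As q → 2πi⟨L, y⟩ with |q| ≤ C(1 +
‖y‖), the limit is ‖f‖²Δ(A_L, f). The weight |q|² is integrable against |S|² because γ > d/2 + 1. In
the product of the two variances the powers of λ cancel. -/

namespace DirUP

/-! ### Decay and smoothness of lattice sums. -/

variable {d : ℕ} {F : Type*} [NormedAddCommGroup F]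

/-- `g` decays at least like `(1 + ‖x‖) ^ (-s)`. -/
def HasDecay (g : Rd d → F) (s : ℝ) : Prop :=
  ∃ C : ℝ, 0 ≤ C ∧ ∀ x, ‖g x‖ ≤ C * (1 + ‖x‖) ^ (-s)

/-- The sum of `g` over the translates of a point by the lattice `lam ℤ^d`. -/
noncomputable def latticeSum (lam : ℝ) (g : Rd d → F) (y : Rd d) : F :=
  ∑' k : Fin d → ℤ, g (y + lam • lat k)

theorem rpow_neg_le_of_le_mul {a b K s : ℝ} (ha : 0 < a) (hb : 0 < b) (hK : 0 < K) (hs : 0 ≤ s)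
    (h : a ≤ K * b) : b ^ (-s) ≤ K ^ s * a ^ (-s) := by
  rw [Real.rpow_neg hb.le, Real.rpow_neg ha.le, ← div_eq_mul_inv, inv_eq_one_div,
    div_le_div_iff₀ (by positivity) (by positivity), one_mul, ← Real.mul_rpow hK.le hb.le]
  exact Real.rpow_le_rpow ha.le h hs

/-- The singular majorant matters only outside the unit ball, where 1 + ‖x‖ ≤ 2‖x‖; inside,
compactness bounds g. -/
theorem HasDecay.of_le_div {g : Rd d → F} {C s : ℝ} (hg : Continuous g) (hC : 0 ≤ C) (hs : 0 ≤ s)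
    (h : ∀ x, x ≠ 0 → ‖g x‖ ≤ C / ‖x‖ ^ s) : HasDecay g s := by
  obtain ⟨M, hM⟩ := (isCompact_closedBall (0 : Rd d) 1).exists_bound_of_continuousOn hg.continuousOn
  have hM0 : 0 ≤ M := (norm_nonneg _).trans (hM 0 (by simp))
  refine ⟨(M + C) * 2 ^ s, by positivity, fun x => ?_⟩
  have hx0 := norm_nonneg x
  rcases le_total ‖x‖ 1 with hx | hx
  · have h1 : ‖g x‖ ≤ M := hM x (by simpa using hx)
    have h2 : (1 : ℝ) ^ (-s) ≤ 2 ^ s * (1 + ‖x‖) ^ (-s) :=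
      rpow_neg_le_of_le_mul (by positivity) one_pos two_pos hs (by linarith)
    rw [Real.one_rpow] at h2
    calc ‖g x‖ ≤ (M + C) * 1 := by linarith
      _ ≤ (M + C) * (2 ^ s * (1 + ‖x‖) ^ (-s)) := by gcongr
      _ = _ := by ring
  · have h1 := h x (by rintro rfl; norm_num at hx)
    rw [div_eq_mul_inv, ← Real.rpow_neg hx0] at h1
    have h2 : ‖x‖ ^ (-s) ≤ 2 ^ s * (1 + ‖x‖) ^ (-s) :=
      rpow_neg_le_of_le_mul (by positivity) (by positivity) two_pos hs (by linarith)
    calc ‖g x‖ ≤ C * ‖x‖ ^ (-s) := h1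
      _ ≤ (M + C) * (2 ^ s * (1 + ‖x‖) ^ (-s)) := by gcongr; linarith
      _ = _ := by ring

theorem summable_one_add_norm_lat {s : ℝ} (hs : (d : ℝ) < s) :
    Summable fun k : Fin d → ℤ => (1 + ‖(lat k : Rd d)‖) ^ (-s) := by
  have hs0 : 0 < s := d.cast_nonneg.trans_lt hs
  let b := (EuclideanSpace.basisFun (Fin d) ℝ).toBasis
  let e := (b.restrictScalars ℤ).equivFun
  have hfin : Module.finrank ℤ (Submodule.span ℤ (Set.range b)) = d := by
    rw [Module.finrank_eq_card_basis (b.restrictScalars ℤ), Fintype.card_fin]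
  have h1 := (ZLattice.summable_norm_rpow (Submodule.span ℤ (Set.range b)) (-s)
    (by rw [hfin]; linarith)).comp_injective e.symm.injective
  have he : ∀ k, ((e.symm k : Submodule.span ℤ (Set.range b)) : Rd d) = lat k := by
    intro k
    simp only [e, Module.Basis.equivFun_symm_apply, Submodule.coe_sum, Submodule.coe_smul,
      Module.Basis.restrictScalars_apply]
    ext j
    simp [b, lat, Pi.single_apply]
  refine Summable.of_norm_bounded_eventually h1 ?_
  -- The origin must be excluded: there ‖k‖ ^ (-s) is 0 by convention and does not dominate 1.
  filter_upwards [(Set.finite_singleton (0 : Fin d → ℤ)).compl_mem_cofinite] with k hk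
  have hk' : lat k ≠ (0 : Rd d) := by
    rw [← he]
    simpa using hk
  rw [Real.norm_of_nonneg (by positivity)]
  simp only [Function.comp_apply, Submodule.coe_norm, he]
  exact Real.rpow_le_rpow_of_nonpos (norm_pos_iff.2 hk') (by linarith) (by linarith)

/-- For fixed λ this is the Weierstrass M-test majorant on a ball. It gives absolute convergence,
continuity and termwise differentiation. -/
theorem HasDecay.lattice_bound {g : Rd d → F} {s : ℝ} (hg : HasDecay g s) (hs : 0 ≤ s)
    {lam : ℝ} (hlam : 0 < lam) (R : ℝ) :
    ∃ C : ℝ, 0 ≤ C ∧ ∀ y, ‖y‖ ≤ R → ∀ k,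
      ‖g (y + lam • lat k)‖ ≤ C * (1 + ‖(lat k : Rd d)‖) ^ (-s) := by
  obtain ⟨C, hC, h⟩ := hg
  have hi : 0 < lam⁻¹ := inv_pos.2 hlam
  refine ⟨C * (1 + lam⁻¹ * |R| + lam⁻¹) ^ s, by positivity, fun y hy k => ?_⟩
  refine (h _).trans ?_
  rw [mul_assoc]
  gcongr
  refine rpow_neg_le_of_le_mul (by positivity) (by positivity) (by positivity) hs ?_
  have h1 : lam * ‖(lat k : Rd d)‖ ≤ ‖y + lam • lat k‖ + |R| := by
    calc lam * ‖(lat k : Rd d)‖ = ‖(y + lam • lat k) - y‖ := by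
          rw [add_sub_cancel_left, norm_smul, Real.norm_of_nonneg hlam.le]
      _ ≤ ‖y + lam • lat k‖ + ‖y‖ := norm_sub_le _ _
      _ ≤ _ := by gcongr; exact hy.trans (le_abs_self R)
  have h2 : ‖(lat k : Rd d)‖ ≤ lam⁻¹ * (‖y + lam • lat k‖ + |R|) := by
    rwa [le_inv_mul_iff₀ hlam]
  have h3 := norm_nonneg (y + lam • lat k)
  have h4 : 0 ≤ lam⁻¹ * |R| * ‖y + lam • lat k‖ := by positivity
  nlinarith

theorem HasDecay.summable [CompleteSpace F] {g : Rd d → F} {s : ℝ} (hg : HasDecay g s)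
    (hs : (d : ℝ) < s) {lam : ℝ} (hlam : 0 < lam) (y : Rd d) :
    Summable fun k : Fin d → ℤ => g (y + lam • lat k) := by
  obtain ⟨C, -, h⟩ := hg.lattice_bound (d.cast_nonneg.trans hs.le) hlam ‖y‖
  exact .of_norm_bounded ((summable_one_add_norm_lat hs).mul_left C) (h y le_rfl)

theorem HasDecay.continuous_latticeSum {g : Rd d → F} {s : ℝ} [CompleteSpace F]
    (hg : HasDecay g s) (hc : Continuous g) (hs : (d : ℝ) < s) {lam : ℝ} (hlam : 0 < lam) :
    Continuous (latticeSum lam g) := by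
  refine continuous_iff_continuousAt.2 fun y => ?_
  obtain ⟨C, -, h⟩ := hg.lattice_bound (d.cast_nonneg.trans hs.le) hlam (‖y‖ + 1)
  have hb : Metric.ball y 1 ∈ 𝓝 y := Metric.ball_mem_nhds y one_pos
  refine ContinuousOn.continuousAt (continuousOn_tsum (s := Metric.ball y 1)
    (fun k => Continuous.continuousOn (by fun_prop))
    ((summable_one_add_norm_lat hs).mul_left C) fun k z hz => h z ?_ k) hb
  have h1 := norm_le_norm_add_norm_sub' z y
  rw [Metric.mem_ball, dist_eq_norm] at hz
  linarith

theorem hasFDerivAt_latticeSum {g : Rd d → ℂ} {s t : ℝ} (hg : HasDecay g s)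
    (hg' : HasDecay (fderiv ℝ g) t) (hd : Differentiable ℝ g) (hs : (d : ℝ) < s)
    (ht : (d : ℝ) < t) {lam : ℝ} (hlam : 0 < lam) (y : Rd d) :
    HasFDerivAt (latticeSum lam g) (latticeSum lam (fderiv ℝ g) y) y := by
  obtain ⟨C, -, h⟩ := hg'.lattice_bound (d.cast_nonneg.trans ht.le) hlam (‖y‖ + 1)
  refine hasFDerivAt_tsum_of_isPreconnected (f := fun k z => g (z + lam • lat k))
    (f' := fun k z => fderiv ℝ g (z + lam • lat k)) (s := Metric.ball y 1)
    ((summable_one_add_norm_lat ht).mul_left C) Metric.isOpen_ball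
    (convex_ball y 1).isPreconnected (fun k z _ => ?_) (fun k z hz => h z ?_ k)
    (Metric.mem_ball_self one_pos) (hg.summable hs hlam y) (Metric.mem_ball_self one_pos)
  · exact (hasFDerivAt_comp_add_right _).2 (hd _).hasFDerivAt
  · have h1 := norm_le_norm_add_norm_sub' z y
    rw [Metric.mem_ball, dist_eq_norm] at hz
    linarith

theorem contDiff_latticeSum {g : Rd d → ℂ} {s t : ℝ} (hg : HasDecay g s)
    (hg' : HasDecay (fderiv ℝ g) t) (hd : ContDiff ℝ 1 g) (hs : (d : ℝ) < s)
    (ht : (d : ℝ) < t) {lam : ℝ} (hlam : 0 < lam) : ContDiff ℝ 1 (latticeSum lam g) := by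
  have h := hasFDerivAt_latticeSum hg hg' (hd.differentiable one_ne_zero) hs ht hlam
  refine contDiff_one_iff_fderiv.2 ⟨fun y => (h y).differentiableAt, ?_⟩
  rw [show fderiv ℝ (latticeSum lam g) = latticeSum lam (fderiv ℝ g) from
    funext fun y => (h y).fderiv]
  exact hg'.continuous_latticeSum (hd.continuous_fderiv one_ne_zero) ht hlam

/-! ### Geometry of the cube, bounds uniform in λ, and pointwise convergence. -/

theorem norm_le_norm_of_forall_abs_le {x y : Rd d} (h : ∀ j, |x j| ≤ |y j|) : ‖x‖ ≤ ‖y‖ := by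
  simp only [EuclideanSpace.norm_eq, Real.norm_eq_abs]
  exact Real.sqrt_le_sqrt (Finset.sum_le_sum fun j _ => pow_le_pow_left₀ (abs_nonneg _) (h j) 2)

/-- For n ≠ 0, |t + n| ≥ |n| - 1/2 ≥ |n|/2 ≥ 1/2 ≥ |t|. -/
theorem abs_le_abs_add_int {t : ℝ} (ht : t ∈ Set.Ico (-(1 / 2) : ℝ) (1 / 2)) (n : ℤ) :
    |t| ≤ |t + n| ∧ |(n : ℝ)| ≤ 2 * |t + n| := by
  have h1 : |t| ≤ 1 / 2 := abs_le.2 ⟨ht.1, ht.2.le⟩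
  rcases eq_or_ne n 0 with rfl | hn
  · simp
  have h2 : (1 : ℝ) ≤ |(n : ℝ)| := by exact_mod_cast Int.one_le_abs hn
  have h3 : |(n : ℝ)| ≤ |t + n| + |t| := by
    simpa using abs_sub (t + n) t
  constructor <;> linarith

theorem norm_le_of_mem_cube {x : Rd d} (hx : x ∈ cube d) (k : Fin d → ℤ) :
    ‖x‖ ≤ ‖x + lat k‖ ∧ ‖(lat k : Rd d)‖ ≤ 2 * ‖x + lat k‖ := by
  constructor
  · exact norm_le_norm_of_forall_abs_le fun j => (abs_le_abs_add_int (hx j) (k j)).1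
  · have h := norm_le_norm_of_forall_abs_le (x := lat k) (y := (2 : ℝ) • (x + lat k)) fun j => by
      rw [PiLp.smul_apply, smul_eq_mul, abs_mul, abs_two]
      exact (abs_le_abs_add_int (hx j) (k j)).2
    rwa [norm_smul, Real.norm_two] at h

theorem norm_le_card_of_mem_cube {x : Rd d} (hx : x ∈ cube d) : ‖x‖ ≤ d := by
  have h : ‖x‖ ^ 2 ≤ (d : ℝ) ^ 2 := by
    rw [EuclideanSpace.norm_sq_eq]
    calc ∑ j, ‖x j‖ ^ 2 ≤ ∑ _j : Fin d, (1 : ℝ) := by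
          gcongr with j
          rw [sq_le_one_iff₀ (norm_nonneg _), Real.norm_eq_abs]
          have := hx j
          exact abs_le.2 ⟨by linarith [this.1], by linarith [this.2]⟩
      _ = d := by simp
      _ ≤ _ := by exact_mod_cast Nat.le_self_pow two_ne_zero d
  exact le_of_sq_le_sq h d.cast_nonneg

/-- The product form separates y from k with a constant free of λ: one factor makes the sum over k
converge, the other is an integrable majorant in y. It rests on (1 + ‖y‖)(1 + ‖k‖) ≤ (3 + 2d)(1 + ‖y
+ λk‖). -/
theorem HasDecay.cube_bound {g : Rd d → F} {s : ℝ} (hg : HasDecay g s) (hs : 0 ≤ s) :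
    ∃ C : ℝ, 0 ≤ C ∧ ∀ lam : ℝ, 1 ≤ lam → ∀ y, lam⁻¹ • y ∈ cube d → ∀ k,
      ‖g (y + lam • lat k)‖ ≤
        C * (1 + ‖y‖) ^ (-s) * (1 + ‖(lat k : Rd d)‖) ^ (-s) := by
  obtain ⟨C, hC, h⟩ := hg
  refine ⟨C * (3 + 2 * d) ^ s, by positivity, fun lam hlam y hy k => (h _).trans ?_⟩
  have h0 : 0 < lam := by linarith
  rw [mul_assoc, mul_assoc, ← Real.mul_rpow (by positivity) (by positivity)]
  gcongr
  refine rpow_neg_le_of_le_mul (by positivity) (by positivity) (by positivity) hs ?_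
  obtain ⟨x, rfl⟩ : ∃ x, y = lam • x := ⟨lam⁻¹ • y, (smul_inv_smul₀ h0.ne' y).symm⟩
  rw [inv_smul_smul₀ h0.ne'] at hy
  obtain ⟨h1, h2⟩ := norm_le_of_mem_cube hy k
  have h3 := norm_le_card_of_mem_cube hy
  rw [← smul_add, norm_smul, norm_smul, Real.norm_of_nonneg h0.le]
  have h4 := norm_nonneg (x + lat k)
  -- With W = ‖y + λk‖, the terms ‖y‖, ‖k‖ and ‖y‖‖k‖ are at most W, 2W and 2dW, which add up to the
  -- factor 3 + 2d.
  have h5 : lam * ‖x‖ ≤ lam * ‖x + lat k‖ := by gcongr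
  have h6 : ‖x + lat k‖ ≤ lam * ‖x + lat k‖ := le_mul_of_one_le_left h4 hlam
  have h7 : lam * ‖x‖ * ‖(lat k : Rd d)‖ ≤ lam * (d * (2 * ‖x + lat k‖)) := by
    rw [mul_assoc]; gcongr
  have h8 : (0 : ℝ) ≤ d := d.cast_nonneg
  nlinarith

theorem HasDecay.latticeSum_le {g : Rd d → F} {s : ℝ} (hg : HasDecay g s)
    (hs : (d : ℝ) < s) :
    ∃ C : ℝ, 0 ≤ C ∧ ∀ lam : ℝ, 1 ≤ lam → ∀ y, lam⁻¹ • y ∈ cube d →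
      ‖latticeSum lam g y‖ ≤ C * (1 + ‖y‖) ^ (-s) := by
  obtain ⟨C, hC, h⟩ := hg.cube_bound (d.cast_nonneg.trans hs.le)
  have hsum := summable_one_add_norm_lat hs
  refine ⟨C * ∑' k : Fin d → ℤ, (1 + ‖(lat k : Rd d)‖) ^ (-s),
    mul_nonneg hC (tsum_nonneg fun k => by positivity), fun lam hlam y hy => ?_⟩
  calc ‖latticeSum lam g y‖
      ≤ ∑' k : Fin d → ℤ, C * (1 + ‖y‖) ^ (-s) * (1 + ‖(lat k : Rd d)‖) ^ (-s) :=
        tsum_of_norm_bounded (hsum.mul_left _).hasSum (h lam hlam y hy)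
    _ = _ := by rw [tsum_mul_left]; ring

theorem cube_mem_nhds_zero : cube d ∈ 𝓝 (0 : Rd d) := by
  have h : (⋂ j : Fin d, (fun x : Rd d => x j) ⁻¹' Set.Ico (-(1 / 2) : ℝ) (1 / 2)) ∈ 𝓝 0 := by
    refine (Filter.iInter_mem).2 fun j => ?_
    have hc : Continuous fun x : Rd d => x j := by fun_prop
    exact hc.continuousAt.preimage_mem_nhds (Ico_mem_nhds (by norm_num) (by norm_num))
  filter_upwards [h] with x hx j
  exact Set.mem_iInter.1 hx j

theorem eventually_inv_smul_mem_cube (y : Rd d) : ∀ᶠ lam : ℝ in atTop, lam⁻¹ • y ∈ cube d := by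
  have h : Tendsto (fun lam : ℝ => lam⁻¹ • y) atTop (𝓝 0) := by
    simpa using (tendsto_inv_atTop_zero (𝕜 := ℝ)).smul_const y
  exact h cube_mem_nhds_zero

theorem HasDecay.tendsto_zero {g : Rd d → F} {s : ℝ} (hg : HasDecay g s) (hs : 0 < s)
    {y v : Rd d} (hv : v ≠ 0) : Tendsto (fun lam : ℝ => g (y + lam • v)) atTop (𝓝 0) := by
  obtain ⟨C, hC, h⟩ := hg
  have h1 : Tendsto (fun lam : ℝ => 1 + ‖y + lam • v‖) atTop atTop := by
    have h2 : Tendsto (fun lam : ℝ => lam * ‖v‖ - ‖y‖) atTop atTop :=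
      tendsto_atTop_add_const_right _ _ (tendsto_id.atTop_mul_const (norm_pos_iff.2 hv))
    refine tendsto_atTop_mono' _ ?_ h2
    filter_upwards [eventually_ge_atTop 0] with lam hlam
    have h3 := norm_sub_le (y + lam • v) y
    rw [add_sub_cancel_left, norm_smul, Real.norm_of_nonneg hlam] at h3
    linarith
  refine squeeze_zero_norm (fun lam => h _) ?_
  simpa using ((tendsto_rpow_neg_atTop hs).comp h1).const_mul C

/-- Dominated convergence for series: each term with k ≠ 0 escapes to infinity, and a fixed y
eventually lies in the dilated cube, where the uniform bound holds. -/
theorem HasDecay.tendsto_latticeSum {g : Rd d → F} {s : ℝ} [CompleteSpace F]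
    (hg : HasDecay g s) (hs : (d : ℝ) < s) (y : Rd d) :
    Tendsto (fun lam : ℝ => latticeSum lam g y) atTop (𝓝 (g y)) := by
  have hs0 : 0 < s := d.cast_nonneg.trans_lt hs
  obtain ⟨C, hC, h⟩ := hg.cube_bound hs0.le
  have hlim : (∑' k : Fin d → ℤ, if k = 0 then g y else 0) = g y := tsum_ite_eq 0 _
  rw [← hlim]
  refine tendsto_tsum_of_dominated_convergence
    ((summable_one_add_norm_lat hs).mul_left (C * (1 + ‖y‖) ^ (-s))) (fun k => ?_) ?_
  · by_cases hk : k = 0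
    · have : (lat (0 : Fin d → ℤ) : Rd d) = 0 := by ext j; simp [lat]
      simp [hk, this]
    · rw [if_neg hk]
      refine hg.tendsto_zero hs0 fun h0 => hk (funext fun j => ?_)
      have : (lat k : Rd d) j = 0 := by rw [h0]; rfl
      simpa [lat] using this
  · filter_upwards [eventually_ge_atTop 1, eventually_inv_smul_mem_cube y] with lam h1 h2 k
    exact h lam h1 y h2 k

end DirUP

/-! ### Integrals over dilated cubes and their limits. -/

namespace DirUP

variable {d : ℕ} {F : Type*} [NormedAddCommGroup F]

/-- The cube `lam [-1/2, 1/2)^d`. -/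
def dilatedCube (d : ℕ) (lam : ℝ) : Set (Rd d) := {y | lam⁻¹ • y ∈ cube d}

theorem measurableSet_cube : MeasurableSet (cube d) := by
  have h : cube d = ⋂ j : Fin d, (fun x : Rd d => x j) ⁻¹' Set.Ico (-(1 / 2) : ℝ) (1 / 2) := by
    ext x
    simp [cube]
  rw [h]
  refine MeasurableSet.iInter fun j => ?_
  have hc : Continuous fun x : Rd d => x j := by fun_prop
  exact hc.measurable measurableSet_Ico

theorem measurableSet_dilatedCube (lam : ℝ) : MeasurableSet (dilatedCube d lam) :=
  (measurable_const_smul lam⁻¹) measurableSet_cube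

/-- The weighted pairing of the lattice sums of `u` and `v` over the dilated cube. -/
noncomputable def pairing (lam : ℝ) (φ u v : Rd d → ℂ) : ℂ :=
  ∫ y in dilatedCube d lam, φ y * (latticeSum lam u y * (starRingEnd ℂ) (latticeSum lam v y))

section Pairing

variable {u v : Rd d → ℂ} {s t m K : ℝ}

/-- The majorant is a multiple of (1 + ‖y‖)^(m - s - t), integrable because d + m < s + t. It is
chosen before λ and φ, as dominated convergence requires. -/
theorem exists_pairing_bound (hu : HasDecay u s) (hv : HasDecay v t)
    (hs : (d : ℝ) < s) (ht : (d : ℝ) < t) (hm : d + m < s + t) (hK : 0 ≤ K) :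
    ∃ B : Rd d → ℝ, Integrable B ∧ (∀ y, 0 ≤ B y) ∧ ∀ lam : ℝ, 1 ≤ lam → ∀ φ : Rd d → ℂ,
      (∀ y, ‖φ y‖ ≤ K * (1 + ‖y‖) ^ m) → ∀ y ∈ dilatedCube d lam,
      ‖φ y * (latticeSum lam u y * (starRingEnd ℂ) (latticeSum lam v y))‖ ≤ B y := by
  obtain ⟨C, hC, hu'⟩ := hu.latticeSum_le hs
  obtain ⟨D, hD, hv'⟩ := hv.latticeSum_le ht
  refine ⟨fun y => K * C * D * (1 + ‖y‖) ^ (-(s + t - m)),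
    (integrable_one_add_norm (by rw [finrank_euclideanSpace_fin]; linarith)).const_mul _,
    fun y => by positivity, fun lam hlam φ hφ y hy => ?_⟩
  rw [norm_mul, norm_mul, RCLike.norm_conj]
  have h1 : 0 < 1 + ‖y‖ := by positivity
  calc _ ≤ (K * (1 + ‖y‖) ^ m) * ((C * (1 + ‖y‖) ^ (-s)) * (D * (1 + ‖y‖) ^ (-t))) := by
        gcongr
        exacts [hφ y, hu' lam hlam y hy, hv' lam hlam y hy]
    _ = _ := by
        beta_reduce
        rw [show -(s + t - m) = m + -s + -t by ring, Real.rpow_add h1, Real.rpow_add h1]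
        ring

theorem integrableOn_pairing (hu : HasDecay u s) (hv : HasDecay v t) (hcu : Continuous u)
    (hcv : Continuous v) (hs : (d : ℝ) < s) (ht : (d : ℝ) < t) (hm : d + m < s + t)
    (hK : 0 ≤ K) {lam : ℝ} (hlam : 1 ≤ lam) {φ : Rd d → ℂ} (hφc : Continuous φ)
    (hφ : ∀ y, ‖φ y‖ ≤ K * (1 + ‖y‖) ^ m) :
    IntegrableOn (fun y => φ y * (latticeSum lam u y * (starRingEnd ℂ) (latticeSum lam v y)))
      (dilatedCube d lam) := by
  obtain ⟨B, hB, -, h⟩ := exists_pairing_bound hu hv hs ht hm hK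
  have hl : 0 < lam := by linarith
  have h1 := hu.continuous_latticeSum hcu hs hl
  have h2 := hv.continuous_latticeSum hcv ht hl
  refine hB.integrableOn.mono' (Continuous.aestronglyMeasurable
    (hφc.mul (h1.mul (Complex.continuous_conj.comp h2)))) ?_
  exact (ae_restrict_mem (measurableSet_dilatedCube lam)).mono fun y hy => h lam hlam φ hφ y hy

theorem tendsto_pairing (hu : HasDecay u s) (hv : HasDecay v t) (hcu : Continuous u)
    (hcv : Continuous v) (hs : (d : ℝ) < s) (ht : (d : ℝ) < t) (hm : d + m < s + t)
    (hK : 0 ≤ K) {φ : ℝ → Rd d → ℂ} {ψ : Rd d → ℂ} (hφc : ∀ lam, Continuous (φ lam))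
    (hφ : ∀ lam, 1 ≤ lam → ∀ y, ‖φ lam y‖ ≤ K * (1 + ‖y‖) ^ m)
    (hlim : ∀ y, Tendsto (fun lam => φ lam y) atTop (𝓝 (ψ y))) :
    Tendsto (fun lam => pairing lam (φ lam) u v) atTop
      (𝓝 (∫ y, ψ y * (u y * (starRingEnd ℂ) (v y)))) := by
  obtain ⟨B, hB, hB0, h⟩ := exists_pairing_bound hu hv hs ht hm hK
  simp_rw [pairing, ← integral_indicator (measurableSet_dilatedCube _)]
  refine tendsto_integral_filter_of_dominated_convergence B ?_ ?_ hB ?_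
  · filter_upwards [eventually_ge_atTop 1] with lam hlam
    exact ((integrableOn_pairing hu hv hcu hcv hs ht hm hK hlam (hφc lam)
      (hφ lam hlam)).integrable_indicator (measurableSet_dilatedCube lam)).aestronglyMeasurable
  · filter_upwards [eventually_ge_atTop 1] with lam hlam
    refine .of_forall fun y => ?_
    by_cases hy : y ∈ dilatedCube d lam
    · rw [Set.indicator_of_mem hy]
      exact h lam hlam _ (hφ lam hlam) y hy
    · rw [Set.indicator_of_notMem hy, norm_zero]
      exact hB0 y
  · refine .of_forall fun y => ?_
    refine Tendsto.congr' ?_ ((hlim y).mul ((hu.tendsto_latticeSum hs y).mul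
      ((Complex.continuous_conj.tendsto _).comp (hv.tendsto_latticeSum ht y))))
    filter_upwards [eventually_inv_smul_mem_cube y] with lam hy
    rw [Set.indicator_of_mem (show y ∈ dilatedCube d lam from hy)]
    rfl

end Pairing

theorem HasDecay.memLp_two {g : Rd d → ℂ} {s : ℝ} (hg : HasDecay g s) (hc : Continuous g)
    (hs : d < 2 * s) : MemLp g 2 volume := by
  obtain ⟨C, hC, h⟩ := hg
  rw [memLp_two_iff_integrable_sq_norm hc.aestronglyMeasurable]
  have hi : Integrable (fun x : Rd d => C ^ 2 * (1 + ‖x‖) ^ (-(2 * s))) :=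
    (integrable_one_add_norm (by rwa [finrank_euclideanSpace_fin])).const_mul _
  refine hi.mono' (by fun_prop) (.of_forall fun x => ?_)
  rw [Real.norm_of_nonneg (by positivity)]
  calc ‖g x‖ ^ 2 ≤ (C * (1 + ‖x‖) ^ (-s)) ^ 2 := by gcongr; exact h x
    _ = _ := by
      rw [mul_pow, ← Real.rpow_natCast ((1 + ‖x‖) ^ (-s)) 2, ← Real.rpow_mul (by positivity)]
      congr 2
      push_cast
      ring

/-- The two normalizing factors √(λ^d) multiply to the Jacobian of y = λx. -/
theorem setIntegral_cube_comp_smul {lam : ℝ} (hlam : 0 < lam) (G : Rd d → ℂ) :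
    ∫ x in cube d, ((Real.sqrt (lam ^ d) : ℂ) * (Real.sqrt (lam ^ d) : ℂ)) * G (lam • x) =
      ∫ y in dilatedCube d lam, G y := by
  rw [integral_const_mul, ← integral_indicator measurableSet_cube,
    ← integral_indicator (measurableSet_dilatedCube lam)]
  have h1 : (fun x => (cube d).indicator (fun x => G (lam • x)) x) =
      fun x => (dilatedCube d lam).indicator G (lam • x) := by
    funext x
    have h2 : lam • x ∈ dilatedCube d lam ↔ x ∈ cube d := by
      change lam⁻¹ • lam • x ∈ cube d ↔ _
      rw [inv_smul_smul₀ hlam.ne']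
    by_cases hx : x ∈ cube d
    · rw [Set.indicator_of_mem hx, Set.indicator_of_mem (h2.2 hx)]
    · rw [Set.indicator_of_notMem hx, Set.indicator_of_notMem (mt h2.1 hx)]
  rw [h1, Measure.integral_comp_smul_of_nonneg volume _ lam (hR := hlam.le),
    finrank_euclideanSpace_fin, ← Complex.ofReal_mul, Real.mul_self_sqrt (by positivity),
    Complex.real_smul, ← mul_assoc, ← Complex.ofReal_mul,
    mul_inv_cancel₀ (by positivity), Complex.ofReal_one, one_mul]

theorem ofReal_normSq (μ : Measure (Rd d)) (g : Rd d → ℂ) : (normSq μ g : ℂ) = ip μ g g := by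
  rw [normSq, ip, ← integral_complex_ofReal]
  congr 1
  funext x
  rw [Complex.mul_conj, Complex.normSq_eq_norm_sq]

theorem normSq_pos {g : Rd d → ℂ} (hc : Continuous g) (h0 : g ≠ 0) (hL : MemLp g 2 volume) :
    0 < normSq volume g := by
  have hnn : 0 ≤ fun x => ‖g x‖ ^ 2 := fun x => by positivity
  refine (integral_nonneg hnn).lt_of_ne fun h => h0 ?_
  have h1 := (integral_eq_zero_iff_of_nonneg hnn
    ((memLp_two_iff_integrable_sq_norm hc.aestronglyMeasurable).1 hL)).1 h.symm
  have h2 := (Continuous.ae_eq_iff_eq volume (by fun_prop) (by fun_prop)).1 h1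
  funext x
  simpa using congrFun h2 x

theorem clm_apply_eq_sum {E : Type*} [NormedAddCommGroup E] [NormedSpace ℝ E]
    (A : Rd d →L[ℝ] E) (v : Rd d) : A v = ∑ j, v j • A (EuclideanSpace.single j 1) := by
  conv_lhs => rw [← (EuclideanSpace.basisFun (Fin d) ℝ).sum_repr v]
  simp

theorem dirD_eq_fderiv (L : Rd d) (g : Rd d → ℂ) (x : Rd d) : dirD L g x = fderiv ℝ g x L := by
  rw [clm_apply_eq_sum]
  simp [dirD, partialD]

theorem norm_fderiv_le_sum_partialD (g : Rd d → ℂ) (x : Rd d) :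
    ‖fderiv ℝ g x‖ ≤ ∑ j, ‖partialD j g x‖ := by
  refine ContinuousLinearMap.opNorm_le_bound _ (by positivity) fun v => ?_
  rw [clm_apply_eq_sum, Finset.sum_mul]
  refine norm_sum_le_of_le _ fun j _ => ?_
  rw [norm_smul, mul_comm]
  exact mul_le_mul_of_nonneg_left (PiLp.norm_apply_le v j) (norm_nonneg _)

theorem HasDecay.clm_comp {E G : Type*} [NormedAddCommGroup E] [NormedSpace ℝ E]
    [NormedAddCommGroup G] [NormedSpace ℝ G] (T : E →L[ℝ] G) {g : Rd d → E} {s : ℝ}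
    (hg : HasDecay g s) : HasDecay (fun x => T (g x)) s := by
  obtain ⟨C, hC, h⟩ := hg
  refine ⟨‖T‖ * C, by positivity, fun x => (T.le_opNorm _).trans ?_⟩
  rw [mul_assoc]
  gcongr
  exact h x

theorem HasDecay.opA {g : Rd d → ℂ} {s : ℝ} (hg : HasDecay g s) (L : Rd d) :
    HasDecay (opA L g) (s - 1) := by
  obtain ⟨C, hC, h⟩ := hg
  refine ⟨2 * Real.pi * ‖L‖ * C, by positivity, fun x => ?_⟩
  have h1 : 0 < 1 + ‖x‖ := by positivity
  rw [DirUP.opA, norm_mul, Complex.norm_real, norm_mul, Real.norm_of_nonneg Real.two_pi_pos.le,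
    show -(s - 1) = 1 + -s by ring, Real.rpow_add h1, Real.rpow_one]
  calc 2 * Real.pi * ‖inner ℝ L x‖ * ‖g x‖
      ≤ 2 * Real.pi * (‖L‖ * (1 + ‖x‖)) * (C * (1 + ‖x‖) ^ (-s)) := by
        gcongr
        · exact (norm_inner_le_norm L x).trans (by gcongr; linarith)
        · exact h x
    _ = _ := by ring

/-- The operator `B_L` as a continuous linear function of the derivative. -/
noncomputable def opBSymbol (L : Rd d) : (Rd d →L[ℝ] ℂ) →L[ℝ] ℂ :=
  (Complex.I / (2 * Real.pi)) • ContinuousLinearMap.apply ℝ ℂ L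

-- Being a continuous linear map applied to the derivative, B_L commutes with lattice sums and
-- inherits the decay of the derivative.
theorem opB_eq (L : Rd d) (g : Rd d → ℂ) (x : Rd d) : opB L g x = opBSymbol L (fderiv ℝ g x) := by
  rw [opB, dirD_eq_fderiv]
  rfl

end DirUP

/-! ### The periodization as a rescaled lattice sum. -/

namespace DirUP

variable {d : ℕ}

theorem periodized_eq (lam : ℝ) (f : Rd d → ℂ) (x : Rd d) :
    periodized lam f x = (Real.sqrt (lam ^ d) : ℂ) * latticeSum lam f (lam • x) := by
  simp only [periodized, scaled, latticeSum, smul_add, tsum_mul_left]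

theorem lat_add (k l : Fin d → ℤ) : (lat (k + l) : Rd d) = lat k + lat l := by
  ext j
  simp [lat]

theorem periodized_add_lat (lam : ℝ) (f : Rd d → ℂ) (x : Rd d) (k : Fin d → ℤ) :
    periodized lam f (x + lat k) = periodized lam f x := by
  simp only [periodized, add_assoc, ← lat_add]
  exact (Equiv.addLeft k).tsum_eq fun l => scaled lam f (x + lat l)

section Periodized

variable {f : Rd d → ℂ} {s t : ℝ}

theorem summable_scaled (hf : HasDecay f s) (hs : (d : ℝ) < s) {lam : ℝ} (hlam : 0 < lam)
    (x : Rd d) : Summable fun k : Fin d → ℤ => scaled lam f (x + lat k) := by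
  simpa only [scaled, smul_add] using (hf.summable hs hlam (lam • x)).mul_left _

theorem contDiff_periodized (hf : HasDecay f s) (hf' : HasDecay (fderiv ℝ f) t)
    (hd : ContDiff ℝ 1 f) (hs : (d : ℝ) < s) (ht : (d : ℝ) < t) {lam : ℝ} (hlam : 0 < lam) :
    ContDiff ℝ 1 (periodized lam f) := by
  rw [funext (periodized_eq lam f)]
  have := contDiff_latticeSum hf hf' hd hs ht hlam
  fun_prop

/-- Differentiation under the lattice sum, with the chain rule for x ↦ λx supplying the extra factor
λ. -/
theorem opB_periodized (hf : HasDecay f s) (hf' : HasDecay (fderiv ℝ f) t)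
    (hd : Differentiable ℝ f) (hs : (d : ℝ) < s) (ht : (d : ℝ) < t) {lam : ℝ} (hlam : 0 < lam)
    (L x : Rd d) : opB L (periodized lam f) x =
      lam * ((Real.sqrt (lam ^ d) : ℂ) * latticeSum lam (opB L f) (lam • x)) := by
  have h1 : HasFDerivAt (fun x : Rd d => lam • x) (lam • ContinuousLinearMap.id ℝ (Rd d)) x :=
    (hasFDerivAt_id x).const_smul lam
  have h2 := ((hasFDerivAt_latticeSum hf hf' hd hs ht hlam (lam • x)).comp x h1).const_mul
    (Real.sqrt (lam ^ d) : ℂ)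
  have h3 : HasFDerivAt (periodized lam f) ((Real.sqrt (lam ^ d) : ℂ) •
      (latticeSum lam (fderiv ℝ f) (lam • x)).comp (lam • ContinuousLinearMap.id ℝ (Rd d))) x := by
    rw [funext (periodized_eq lam f)]
    exact h2
  have h4 : latticeSum lam (opB L f) (lam • x) =
      opBSymbol L (latticeSum lam (fderiv ℝ f) (lam • x)) := by
    rw [latticeSum, latticeSum, (opBSymbol L).map_tsum (hf'.summable ht hlam _)]
    simp only [opB_eq]
  rw [opB_eq, h3.fderiv, h4]
  simp [opBSymbol]
  ring

end Periodized

/-! ### The dilated character and its difference quotient. -/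

/-- The character `y ↦ exp(2πi⟨L, y⟩ / lam)`. -/
noncomputable def dilatedChar (L : Rd d) (lam : ℝ) (y : Rd d) : ℂ :=
  Complex.exp (Complex.I * ((2 * Real.pi * inner ℝ L y / lam : ℝ) : ℂ))

theorem opAT_eq (L : Rd d) {lam : ℝ} (hlam : lam ≠ 0) (g : Rd d → ℂ) (x : Rd d) :
    opAT L g x = dilatedChar L lam (lam • x) * g x := by
  rw [opAT, dilatedChar, inner_smul_right]
  congr 2
  rw [show 2 * Real.pi * (lam * inner ℝ L x) / lam = 2 * Real.pi * inner ℝ L x by field_simp]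
  push_cast
  ring

theorem continuous_dilatedChar (L : Rd d) (lam : ℝ) : Continuous (dilatedChar L lam) := by
  unfold dilatedChar
  fun_prop

theorem norm_dilatedChar (L : Rd d) (lam : ℝ) (y : Rd d) : ‖dilatedChar L lam y‖ = 1 := by
  rw [dilatedChar, mul_comm, Complex.norm_exp_ofReal_mul_I]

/-- This is the right derivative at 0 of r ↦ exp(iar), taken along r = 1/λ. -/
theorem tendsto_mul_exp_sub_one (a : ℝ) :
    Tendsto (fun lam : ℝ => (lam : ℂ) * (Complex.exp (Complex.I * ((a / lam : ℝ) : ℂ)) - 1)) atTop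
      (𝓝 (Complex.I * a)) := by
  have h1 : HasDerivAt (fun r : ℝ => Complex.exp (Complex.I * ((a * r : ℝ) : ℂ)))
      (Complex.I * a) 0 := by
    have h2 : HasDerivAt (fun r : ℝ => Complex.I * ((a * r : ℝ) : ℂ)) (Complex.I * a) 0 := by
      have := (((hasDerivAt_id (0 : ℝ)).const_mul a).ofReal_comp).const_mul Complex.I
      simpa using this
    simpa using h2.cexp
  have h3 := h1.tendsto_slope_zero_right.comp tendsto_inv_atTop_nhdsGT_zero
  simpa [Function.comp_def, div_eq_mul_inv] using h3

theorem tendsto_dilatedChar (L y : Rd d) :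
    Tendsto (fun lam => dilatedChar L lam y) atTop (𝓝 1) := by
  have h := (tendsto_inv_atTop_zero (𝕜 := ℝ)).const_mul (2 * Real.pi * inner ℝ L y)
  have hc : Continuous fun r : ℝ => Complex.exp (Complex.I * (r : ℂ)) := by fun_prop
  simpa [Function.comp_def, dilatedChar, div_eq_mul_inv] using (hc.tendsto _).comp h

theorem norm_mul_dilatedChar_sub_one_le (L : Rd d) {lam : ℝ} (hlam : 0 < lam) (y : Rd d) :
    ‖(lam : ℂ) * (dilatedChar L lam y - 1)‖ ≤ 2 * Real.pi * ‖L‖ * (1 + ‖y‖) := by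
  rw [norm_mul, Complex.norm_real, Real.norm_of_nonneg hlam.le]
  calc lam * ‖dilatedChar L lam y - 1‖ ≤ lam * ‖2 * Real.pi * inner ℝ L y / lam‖ := by
        gcongr
        exact Real.norm_exp_I_mul_ofReal_sub_one_le
    _ = 2 * Real.pi * ‖inner ℝ L y‖ := by
        rw [norm_div, norm_mul, Real.norm_of_nonneg hlam.le,
          Real.norm_of_nonneg Real.two_pi_pos.le]
        field_simp
    _ ≤ 2 * Real.pi * (‖L‖ * (1 + ‖y‖)) := by
        gcongr
        exact (norm_inner_le_norm L y).trans (by gcongr; linarith)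
    _ = _ := by ring

/-- The difference quotient of the character in the step `1 / lam`. -/
noncomputable def charQuot (L : Rd d) (lam : ℝ) (y : Rd d) : ℂ :=
  (lam : ℂ) * (dilatedChar L lam y - 1)

/-- The squared modulus of `charQuot`. -/
noncomputable def charQuotSq (L : Rd d) (lam : ℝ) (y : Rd d) : ℂ :=
  charQuot L lam y * (starRingEnd ℂ) (charQuot L lam y)

theorem tendsto_charQuot (L y : Rd d) :
    Tendsto (fun lam => charQuot L lam y) atTop
      (𝓝 (Complex.I * ((2 * Real.pi * inner ℝ L y : ℝ) : ℂ))) :=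
  tendsto_mul_exp_sub_one _

theorem tendsto_charQuotSq (L y : Rd d) :
    Tendsto (fun lam => charQuotSq L lam y) atTop
      (𝓝 (((2 * Real.pi * inner ℝ L y : ℝ) : ℂ) ^ 2)) := by
  have h := (tendsto_charQuot L y).mul
    ((Complex.continuous_conj.tendsto _).comp (tendsto_charQuot L y))
  convert! h using 2
  rw [map_mul, Complex.conj_I, Complex.conj_ofReal]
  linear_combination ((2 * Real.pi * inner ℝ L y : ℝ) : ℂ) ^ 2 * Complex.I_sq

theorem continuous_charQuot (L : Rd d) (lam : ℝ) : Continuous (charQuot L lam) := by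
  have := continuous_dilatedChar L lam
  unfold charQuot
  fun_prop

theorem continuous_charQuotSq (L : Rd d) (lam : ℝ) : Continuous (charQuotSq L lam) :=
  (continuous_charQuot L lam).mul (Complex.continuous_conj.comp (continuous_charQuot L lam))

/-- Since |χ| = 1, |χ - 1|² = 2 - χ - conj χ, which is linear in χ and its conjugate and can be
integrated termwise. -/
theorem charQuotSq_eq (L : Rd d) (lam : ℝ) (y : Rd d) :
    charQuotSq L lam y = (lam : ℂ) ^ 2 *
      (2 - dilatedChar L lam y - (starRingEnd ℂ) (dilatedChar L lam y)) := by
  have h : dilatedChar L lam y * (starRingEnd ℂ) (dilatedChar L lam y) = 1 := by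
    rw [Complex.mul_conj, Complex.normSq_eq_norm_sq, norm_dilatedChar]
    simp
  simp only [charQuotSq, charQuot, map_mul, map_sub, map_one, Complex.conj_ofReal]
  linear_combination (lam : ℂ) ^ 2 * h

section Pairing

variable {f : Rd d → ℂ} {s : ℝ}

theorem pairing_charQuot (hf : HasDecay f s) (hc : Continuous f) (hs : (d : ℝ) < s)
    (L : Rd d) {lam : ℝ} (hlam : 1 ≤ lam) :
    pairing lam (charQuot L lam) f f =
      lam * (pairing lam (dilatedChar L lam) f f - pairing lam 1 f f) := by
  have h0 : (d : ℝ) + 0 < s + s := by have := d.cast_nonneg (α := ℝ); linarith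
  have h1 := integrableOn_pairing hf hf hc hc hs hs h0 zero_le_one hlam
    (continuous_dilatedChar L lam) (fun y => by simp [norm_dilatedChar])
  have h2 := integrableOn_pairing (φ := 1) hf hf hc hc hs hs h0 zero_le_one hlam
    continuous_one (fun y => by simp)
  rw [pairing, pairing, pairing, ← integral_sub h1 h2, ← integral_const_mul]
  congr 1
  funext y
  simp only [charQuot, Pi.one_apply]
  ring

theorem pairing_charQuotSq (hf : HasDecay f s) (hc : Continuous f) (hs : (d : ℝ) < s)
    (L : Rd d) {lam : ℝ} (hlam : 1 ≤ lam) :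
    pairing lam (charQuotSq L lam) f f = (lam : ℂ) ^ 2 * (2 * pairing lam 1 f f -
      pairing lam (dilatedChar L lam) f f -
      (starRingEnd ℂ) (pairing lam (dilatedChar L lam) f f)) := by
  have h0 : (d : ℝ) + 0 < s + s := by have := d.cast_nonneg (α := ℝ); linarith
  have h1 := integrableOn_pairing hf hf hc hc hs hs h0 zero_le_one hlam
    (continuous_dilatedChar L lam) (fun y => by simp [norm_dilatedChar])
  have h2 := integrableOn_pairing (φ := 1) hf hf hc hc hs hs h0 zero_le_one hlam
    continuous_one (fun y => by simp)
  have h3 := integrableOn_pairing (φ := fun y => (starRingEnd ℂ) (dilatedChar L lam y))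
    hf hf hc hc hs hs h0 zero_le_one hlam
    (Complex.continuous_conj.comp (continuous_dilatedChar L lam))
    (fun y => by simp [norm_dilatedChar])
  have h5 : IntegrableOn (fun y => 2 * ((1 : Rd d → ℂ) y * (latticeSum lam f y *
      (starRingEnd ℂ) (latticeSum lam f y))) - dilatedChar L lam y * (latticeSum lam f y *
      (starRingEnd ℂ) (latticeSum lam f y))) (dilatedCube d lam) := (h2.const_mul 2).sub h1
  have h4 : (starRingEnd ℂ) (pairing lam (dilatedChar L lam) f f) =
      pairing lam (fun y => (starRingEnd ℂ) (dilatedChar L lam y)) f f := by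
    rw [pairing, ← integral_conj, pairing]
    congr 1
    funext y
    simp only [map_mul, Complex.conj_conj]
    ring
  rw [h4, pairing, pairing, pairing, pairing, ← integral_const_mul,
    ← integral_sub (h2.const_mul 2) h1, ← integral_sub h5 h3,
    ← integral_const_mul]
  congr 1
  funext y
  simp only [charQuotSq_eq, Pi.one_apply]
  ring

end Pairing

/-! ### Torus inner products as pairings. -/

section Torus

variable {f : Rd d → ℂ} {s t : ℝ} {lam : ℝ}

theorem ip_torus_eq_pairing (hlam : 0 < lam) {p q u v φ : Rd d → ℂ} (a : ℂ)
    (h : ∀ x, p x * (starRingEnd ℂ) (q x) = a *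
      (((Real.sqrt (lam ^ d) : ℂ) * (Real.sqrt (lam ^ d) : ℂ)) * (φ (lam • x) *
        (latticeSum lam u (lam • x) * (starRingEnd ℂ) (latticeSum lam v (lam • x)))))) :
    ip (torusMeasure d) p q = a * pairing lam φ u v := by
  rw [ip, torusMeasure]
  simp only [h]
  rw [integral_const_mul, setIntegral_cube_comp_smul hlam fun y => φ y *
    (latticeSum lam u y * (starRingEnd ℂ) (latticeSum lam v y))]
  rfl

theorem ip_periodized (hlam : 0 < lam) (f : Rd d → ℂ) :
    ip (torusMeasure d) (periodized lam f) (periodized lam f) = pairing lam 1 f f := by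
  rw [ip_torus_eq_pairing hlam 1, one_mul]
  intro x
  simp only [periodized_eq, map_mul, Complex.conj_ofReal, Pi.one_apply]
  ring

theorem ip_opAT_periodized (hlam : 0 < lam) (f : Rd d → ℂ) (L : Rd d) :
    ip (torusMeasure d) (opAT L (periodized lam f)) (periodized lam f) =
      pairing lam (dilatedChar L lam) f f := by
  rw [ip_torus_eq_pairing hlam 1, one_mul]
  intro x
  simp only [opAT_eq L hlam.ne', periodized_eq, map_mul, Complex.conj_ofReal]
  ring

theorem ip_opB_periodized (hf : HasDecay f s) (hf' : HasDecay (fderiv ℝ f) t)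
    (hd : Differentiable ℝ f) (hs : (d : ℝ) < s) (ht : (d : ℝ) < t) (hlam : 0 < lam) (L : Rd d) :
    ip (torusMeasure d) (opB L (periodized lam f)) (periodized lam f) =
      lam * pairing lam 1 (opB L f) f := by
  rw [ip_torus_eq_pairing hlam lam]
  intro x
  simp only [opB_periodized hf hf' hd hs ht hlam, periodized_eq, map_mul, Complex.conj_ofReal,
    Pi.one_apply]
  ring

theorem ip_opB_opB_periodized (hf : HasDecay f s) (hf' : HasDecay (fderiv ℝ f) t)
    (hd : Differentiable ℝ f) (hs : (d : ℝ) < s) (ht : (d : ℝ) < t) (hlam : 0 < lam) (L : Rd d) :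
    ip (torusMeasure d) (opB L (periodized lam f)) (opB L (periodized lam f)) =
      lam ^ 2 * pairing lam 1 (opB L f) (opB L f) := by
  rw [ip_torus_eq_pairing hlam (lam ^ 2)]
  intro x
  simp only [opB_periodized hf hf' hd hs ht hlam, map_mul, Complex.conj_ofReal,
    Pi.one_apply]
  ring

end Torus

/-- The part of admissibility that the limit relation rests on. -/
theorem Admissible.exists_decay {f : Rd d → ℂ} (hf : Admissible f) :
    ∃ s t : ℝ, (d : ℝ) < s ∧ (d : ℝ) / 2 + 1 < s ∧ (d : ℝ) < t ∧ HasDecay f s ∧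
      HasDecay (fderiv ℝ f) t := by
  obtain ⟨C₁, C₂, γ, β, h1, h2, hβ, hγ, hf1, hf2⟩ := hf.decay
  obtain ⟨hγ1, hγ2⟩ := max_lt_iff.1 hγ
  have hd0 := d.cast_nonneg (α := ℝ)
  refine ⟨γ, β, hγ2, hγ1, hβ, .of_le_div hf.contDiff.continuous h1.le (hd0.trans hγ2.le) hf1,
    .of_le_div (C := d * C₂) (hf.contDiff.continuous_fderiv one_ne_zero) (by positivity)
      (hd0.trans hβ.le) fun x hx => ?_⟩
  calc ‖fderiv ℝ f x‖ ≤ ∑ j, ‖partialD j f x‖ := norm_fderiv_le_sum_partialD f x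
    _ ≤ ∑ _j : Fin d, C₂ / ‖x‖ ^ β := Finset.sum_le_sum fun j _ => hf2 x hx j
    _ = _ := by simp [mul_div_assoc]

end DirUP

/-! ### Limits of norms and variances. -/

namespace DirUP

variable {d : ℕ} {f : Rd d → ℂ} {s t : ℝ}

theorem tendsto_pairing_one {u v : Rd d → ℂ} (hu : HasDecay u s) (hv : HasDecay v t)
    (hcu : Continuous u) (hcv : Continuous v) (hs : (d : ℝ) < s) (ht : (d : ℝ) < t) :
    Tendsto (fun lam => pairing lam 1 u v) atTop (𝓝 (ip volume u v)) := by
  have h0 : (d : ℝ) + 0 < s + t := by have := d.cast_nonneg (α := ℝ); linarith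
  have h := tendsto_pairing (φ := fun _ => 1) (ψ := 1) hu hv hcu hcv hs ht h0 zero_le_one
    (fun _ => continuous_one) (fun _ _ y => by simp) (fun y => tendsto_const_nhds)
  simpa [ip] using h

theorem tendsto_normSq_periodized (hf : HasDecay f s) (hc : Continuous f) (hs : (d : ℝ) < s) :
    Tendsto (fun lam => normSq (torusMeasure d) (periodized lam f)) atTop
      (𝓝 (normSq volume f)) := by
  have h := (Complex.continuous_re.tendsto _).comp (tendsto_pairing_one hf hf hc hc hs hs)
  rw [← ofReal_normSq, Complex.ofReal_re] at h
  refine h.congr' ?_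
  filter_upwards [eventually_gt_atTop 0] with lam hlam
  rw [Function.comp_apply, ← ip_periodized hlam, ← ofReal_normSq, Complex.ofReal_re]

theorem tendsto_ip_opAT_periodized (hf : HasDecay f s) (hc : Continuous f) (hs : (d : ℝ) < s)
    (L : Rd d) :
    Tendsto (fun lam => ip (torusMeasure d) (opAT L (periodized lam f)) (periodized lam f)) atTop
      (𝓝 (normSq volume f)) := by
  have h0 : (d : ℝ) + 0 < s + s := by have := d.cast_nonneg (α := ℝ); linarith
  have h := tendsto_pairing (φ := dilatedChar L) (ψ := 1) hf hf hc hc hs hs h0 zero_le_one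
    (continuous_dilatedChar L) (fun _ _ y => by simp [norm_dilatedChar]) (tendsto_dilatedChar L)
  have h1 : ∫ y, (1 : Rd d → ℂ) y * (f y * (starRingEnd ℂ) (f y)) = (normSq volume f : ℂ) := by
    rw [ofReal_normSq]
    simp [ip]
  rw [h1] at h
  refine h.congr' ?_
  filter_upwards [eventually_gt_atTop 0] with lam hlam
  rw [ip_opAT_periodized hlam]

theorem tendsto_pairing_charQuot (hf : HasDecay f s) (hc : Continuous f) (hs : (d : ℝ) < s)
    (hs' : (d : ℝ) / 2 + 1 < s) (L : Rd d) :
    Tendsto (fun lam => ‖pairing lam (charQuot L lam) f f‖) atTop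
      (𝓝 ‖ip volume (opA L f) f‖) := by
  have h := tendsto_pairing (m := 1) (K := 2 * Real.pi * ‖L‖) (φ := charQuot L)
    hf hf hc hc hs hs (by have := d.cast_nonneg (α := ℝ); linarith) (by positivity)
    (continuous_charQuot L) (fun lam hlam y => by
      rw [Real.rpow_one]
      exact norm_mul_dilatedChar_sub_one_le L (by linarith) y) (tendsto_charQuot L)
  have h1 : ∫ y, Complex.I * ((2 * Real.pi * inner ℝ L y : ℝ) : ℂ) *
      (f y * (starRingEnd ℂ) (f y)) = Complex.I * ip volume (opA L f) f := by
    rw [ip, ← integral_const_mul]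
    congr 1
    funext y
    rw [opA]
    ring
  rw [h1] at h
  simpa using h.norm

theorem tendsto_pairing_charQuotSq (hf : HasDecay f s) (hc : Continuous f) (hs : (d : ℝ) < s)
    (hs' : (d : ℝ) / 2 + 1 < s) (L : Rd d) :
    Tendsto (fun lam => (pairing lam (charQuotSq L lam) f f).re) atTop
      (𝓝 (normSq volume (opA L f))) := by
  -- A weight of quadratic growth needs d + 2 < 2s, which is twice the hypothesis d/2 + 1 < s.
  have h := tendsto_pairing (m := 2) (K := (2 * Real.pi * ‖L‖) ^ 2) (φ := charQuotSq L)
    hf hf hc hc hs hs (by linarith) (by positivity)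
    (continuous_charQuotSq L) (fun lam hlam y => by
      rw [charQuotSq, norm_mul, RCLike.norm_conj, ← pow_two, Real.rpow_two, ← mul_pow]
      gcongr
      exact norm_mul_dilatedChar_sub_one_le L (by linarith) y) (tendsto_charQuotSq L)
  have h1 : ∫ y, ((2 * Real.pi * inner ℝ L y : ℝ) : ℂ) ^ 2 *
      (f y * (starRingEnd ℂ) (f y)) = (normSq volume (opA L f) : ℂ) := by
    rw [ofReal_normSq, ip]
    congr 1
    funext y
    rw [opA, map_mul, Complex.conj_ofReal]
    ring
  rw [h1] at h
  simpa [Function.comp_def] using (Complex.continuous_re.tendsto _).comp h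

/-- The leading terms of N² - |P|² cancel; this exact identity writes the remainder through q, so
that both pairings on the right have finite limits. -/
theorem varAng_periodized (hf : HasDecay f s) (hc : Continuous f) (hs : (d : ℝ) < s) (L : Rd d)
    {lam : ℝ} (hlam : 1 ≤ lam)
    (h0 : ip (torusMeasure d) (opAT L (periodized lam f)) (periodized lam f) ≠ 0) :
    lam ^ 2 * varAng L (periodized lam f) =
      (normSq (torusMeasure d) (periodized lam f) * (pairing lam (charQuotSq L lam) f f).re -
        ‖pairing lam (charQuot L lam) f f‖ ^ 2) /
      ‖ip (torusMeasure d) (opAT L (periodized lam f)) (periodized lam f)‖ ^ 2 := by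
  have hl : 0 < lam := by linarith
  have h1 := pairing_charQuot hf hc hs L hlam
  have h2 := pairing_charQuotSq hf hc hs L hlam
  rw [← ip_periodized hl, ← ofReal_normSq, ← ip_opAT_periodized hl] at h1 h2
  rw [varAng, eq_div_iff (by positivity), mul_assoc, sub_mul, one_mul,
    div_mul_cancel₀ _ (by positivity), h1, h2]
  simp only [← Complex.normSq_eq_norm_sq, Complex.normSq_apply]
  simp [pow_two]
  ring

theorem tendsto_varAng_periodized (hf : HasDecay f s) (hc : Continuous f) (hs : (d : ℝ) < s)
    (hs' : (d : ℝ) / 2 + 1 < s) (hn : 0 < normSq volume f) (L : Rd d) :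
    Tendsto (fun lam => lam ^ 2 * varAng L (periodized lam f)) atTop
      (𝓝 (variance (opA L) f / normSq volume f)) := by
  have hz := tendsto_ip_opAT_periodized hf hc hs L
  have h := (((tendsto_normSq_periodized hf hc hs).mul
    (tendsto_pairing_charQuotSq hf hc hs hs' L)).sub
    ((tendsto_pairing_charQuot hf hc hs hs' L).pow 2)).div (hz.norm.pow 2)
    (by rw [Complex.norm_real, Real.norm_of_nonneg hn.le]; positivity)
  have hlim : (normSq volume f * normSq volume (opA L f) - ‖ip volume (opA L f) f‖ ^ 2) /
      ‖(normSq volume f : ℂ)‖ ^ 2 = variance (opA L) f / normSq volume f := by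
    rw [Complex.norm_real, Real.norm_of_nonneg hn.le, variance]
    field_simp
  rw [hlim] at h
  refine h.congr' ?_
  filter_upwards [eventually_ge_atTop 1,
    hz.eventually_ne (Complex.ofReal_ne_zero.2 hn.ne')] with lam h1 h2
  exact (varAng_periodized hf hc hs L h1 h2).symm

theorem tendsto_varFreq_periodized (hf : HasDecay f s) (hf' : HasDecay (fderiv ℝ f) t)
    (hd : ContDiff ℝ 1 f) (hs : (d : ℝ) < s) (ht : (d : ℝ) < t) (hn : 0 < normSq volume f)
    {L : Rd d} (hb : HasDecay (opB L f) t) (hbc : Continuous (opB L f)) :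
    Tendsto (fun lam => varFreq L (periodized lam f) / lam ^ 2) atTop
      (𝓝 (variance (opB L) f / normSq volume f)) := by
  have hc := hd.continuous
  have hdd := hd.differentiable one_ne_zero
  have hN := tendsto_normSq_periodized hf hc hs
  have hB := (Complex.continuous_re.tendsto _).comp (tendsto_pairing_one hb hb hbc hbc ht ht)
  rw [← ofReal_normSq, Complex.ofReal_re] at hB
  have h := (hB.div hN hn.ne').sub
    (((tendsto_pairing_one hb hf hbc hc ht hs).norm.pow 2).div (hN.pow 2) (by positivity))
  have hlim : normSq volume (opB L f) / normSq volume f -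
      ‖ip volume (opB L f) f‖ ^ 2 / normSq volume f ^ 2 =
      variance (opB L) f / normSq volume f := by
    rw [variance]
    field_simp
  rw [hlim] at h
  refine h.congr' ?_
  filter_upwards [eventually_gt_atTop 0] with lam hlam
  have h1 := congrArg Complex.re (ip_opB_opB_periodized hf hf' hdd hs ht hlam L)
  rw [← ofReal_normSq, Complex.ofReal_re, ← Complex.ofReal_pow, Complex.re_ofReal_mul] at h1
  rw [varFreq, h1, ip_opB_periodized hf hf' hdd hs ht hlam, norm_mul, Complex.norm_real,
    Real.norm_of_nonneg hlam.le, sub_div]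
  simp only [Pi.div_apply, Function.comp_apply]
  congr 1 <;> field_simp

end DirUP

theorem theorem3p1 (d : ℕ) (f : DirUP.Rd d → ℂ) (hf : DirUP.Admissible f)
    (L : Fin d → ℤ) (hL : L ≠ 0) :
    (∀ lam : ℝ, 0 < lam →
      (∀ x, Summable fun k : Fin d → ℤ => DirUP.scaled lam f (x + DirUP.lat k)) ∧
      (∀ x (k : Fin d → ℤ),
        DirUP.periodized lam f (x + DirUP.lat k) = DirUP.periodized lam f x) ∧
      ContDiff ℝ 1 (DirUP.periodized lam f)) ∧
    (∀ᶠ lam : ℝ in atTop,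
      DirUP.normSq (DirUP.torusMeasure d) (DirUP.periodized lam f) ≠ 0 ∧
      DirUP.ip (DirUP.torusMeasure d) (DirUP.opAT (DirUP.lat L) (DirUP.periodized lam f))
        (DirUP.periodized lam f) ≠ 0) ∧
    (MemLp (DirUP.opA (DirUP.lat L) f) 2 volume ∧ MemLp (DirUP.opB (DirUP.lat L) f) 2 volume) ∧
    Tendsto (fun lam : ℝ => DirUP.UPT (DirUP.lat L) (DirUP.periodized lam f)) atTop
      (𝓝 (DirUP.UP (DirUP.lat L) f)) := by
  obtain ⟨s, t, hs, hs', ht, hfs, hft⟩ := hf.exists_decay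
  have hd := hf.contDiff
  have hc := hd.continuous
  have hc' := hd.continuous_fderiv one_ne_zero
  have hn := DirUP.normSq_pos hc hf.ne_zero hf.memLp
  have hd0 := d.cast_nonneg (α := ℝ)
  have hb : DirUP.HasDecay (DirUP.opB (DirUP.lat L) f) t := by
    rw [funext (DirUP.opB_eq (DirUP.lat L) f)]
    exact hft.clm_comp _
  have hbc : Continuous (DirUP.opB (DirUP.lat L) f) := by
    rw [funext (DirUP.opB_eq (DirUP.lat L) f)]
    fun_prop
  have hac : Continuous (DirUP.opA (DirUP.lat L) f) := by
    unfold DirUP.opA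
    fun_prop
  refine ⟨fun lam hlam => ⟨DirUP.summable_scaled hfs hs hlam, DirUP.periodized_add_lat lam f,
    DirUP.contDiff_periodized hfs hft hd hs ht hlam⟩, ?_,
    ⟨(hfs.opA _).memLp_two hac (by linarith), hb.memLp_two hbc (by linarith)⟩, ?_⟩
  · exact ((DirUP.tendsto_normSq_periodized hfs hc hs).eventually_ne hn.ne').and
      ((DirUP.tendsto_ip_opAT_periodized hfs hc hs _).eventually_ne
        (Complex.ofReal_ne_zero.2 hn.ne'))
  -- The factors λ² and λ⁻² in the two limits cancel in the product.
  · have h := ((DirUP.tendsto_varAng_periodized hfs hc hs hs' hn (DirUP.lat L)).mul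
      (DirUP.tendsto_varFreq_periodized hfs hft hd hs ht hn hb hbc)).const_mul
        (1 / ‖(DirUP.lat L : DirUP.Rd d)‖ ^ 4)
    have hlim : 1 / ‖(DirUP.lat L : DirUP.Rd d)‖ ^ 4 *
        (DirUP.variance (DirUP.opA (DirUP.lat L)) f / DirUP.normSq volume f *
          (DirUP.variance (DirUP.opB (DirUP.lat L)) f / DirUP.normSq volume f)) =
        DirUP.UP (DirUP.lat L) f := by
      rw [DirUP.UP, div_mul_div_comm, div_mul_div_comm, one_mul, pow_two (DirUP.normSq volume f)]
    rw [hlim] at h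
    refine h.congr' ?_
    filter_upwards [eventually_gt_atTop 0] with lam hlam
    rw [DirUP.UPT]
    field_simp
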